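/- Let $(R,\mathfrak m,k)$ be a commutative Noetherian local ring, and let all modules be finitely generated. For a sequence $\{a_n\}$ of non-negative real numbers, let $\operatorname{cx}\{a_n\}$ be the smallest integer $b\ge 0$ such that, for some constant $\alpha>0$, $a_n\le\alpha n^{b-1}$ for all $n\gg 0$ (and $\infty$ if there is no such $b$), and let $\operatorname{curv}\{a_n\}=\limsup_{n\to\infty}\sqrt[n]{a_n}\in[0,\infty]$. Write $\mu_R(-)$ for the minimal number of generators. For $R$-modules $M,N$ put $$\operatorname{cx}_R(N)=\operatorname{cx}\{\operatorname{rank}_k\operatorname{Ext}^n_R(N,k)\},\quad \operatorname{injcx}_R(N)=\operatorname{cx}\{\operatorname{rank}_k\operatorname{Ext}^n_R(k,N)\},$$ $$\operatorname{cx}_R(M,N)=\operatorname{cx}\{\mu_R(\operatorname{Ext}_R^n(M,N))\},\quad \operatorname{tcx}_R(M,N)=\operatorname{cx}\{\mu_R(\operatorname{Tor}^R_n(M,N))\},$$ and let $\operatorname{curv}_R(N)$, $\operatorname{injcurv}_R(N)$, $\operatorname{curv}_R(M,N)$, $\operatorname{tcurv}_R(M,N)$ be the curvatures of the same four sequences,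 respectively. A submodule $M$ of an $R$-module $X$ is called Burch if $\mathfrak m(M:_X\mathfrak m)\ne\mathfrak m M$, where $(M:_X\mathfrak m)=\{x\in X:\mathfrak m x\subseteq M\}$. With $(-)^*=\operatorname{Hom}_R(-,R)$, a module $X$ is called torsionless if the canonical map $X\to X^{**}$ is injective, and totally reflexive if that map is bijective and $\operatorname{Ext}^i_R(X,R)=0=\operatorname{Ext}^i_R(X^*,R)$ for all $i\ge 1$; $X$ has finite G-dimension if there is an exact sequence $0\to G_n\to\cdots\to G_0\to X\to 0$ with all $G_i$ totally reflexive. **Theorem.** Let $M$ and $N$ be $R$-modules such that $M$ is a Burch submodule of some $R$-module $X$. Assume that $X$ has finite G-dimension or that $X$ is torsionless. 1. If there is an $h>0$ such that $\mathfrak m^h\operatorname{Tor}^R_n(M,N)=0$ for all $n\gg 0$, then $\operatorname{cx}_R(N)\le\operatorname{tcx}_R(M,N)$ and $\operatorname{curv}_R(N)\le\operatorname{tcurv}_R(M,N)$. 2. If there is an $h>0$ such that $\mathfrak m^h\operatorname{Ext}_R^n(M,N)=0$ for all $n\gg 0$, then $\operatorname{injcx}_R(N)\le\operatorname{cx}_R(M,N)$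 and $\operatorname{injcurv}_R(N)\le\operatorname{curv}_R(M,N)$. -/

import Mathlib

universe u

open CategoryTheory IsLocalRing Filter

noncomputable section

namespace BurchGrowth

/-! ### Growth of sequences -/

/-- The complexity of a sequence of non-negative reals: the smallest integer `b ≥ 0` such that
`a n ≤ α n ^ (b - 1)` for all large `n` and some constant `α > 0`, and `∞` if there is none. -/
def cxSeq (a : ℕ → ℝ) : ℕ∞ :=
  ⨅ (b : ℕ) (_ : ∃ α : ℝ, 0 < α ∧ ∀ᶠ n : ℕ in atTop, a n ≤ α * (n : ℝ) ^ ((b : ℤ) - 1)), (b : ℕ∞)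

/-- The curvature of a sequence of non-negative reals: `limsup` of the `n`-th roots,
as an element of `[0, ∞]`. -/
def curvSeq (a : ℕ → ℝ) : ENNReal :=
  limsup (fun n : ℕ => ENNReal.ofReal (a n ^ (1 / (n : ℝ)))) atTop

section Modules

variable (R : Type u) [CommRing R]

/-! ### Tor, Ext and numbers of generators -/

/-- The `R`-module `Tor_n^R(M, N)`. -/
abbrev TorMod (n : ℕ) (M N : Type u) [AddCommGroup M] [Module R M] [AddCommGroup N]
    [Module R N] : Type u :=
  ((((Tor (ModuleCat.{u} R) n).obj (ModuleCat.of R M)).obj (ModuleCat.of R N) : ModuleCat.{u} R) :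
    Type u)

/-- The `R`-module `Ext^n_R(M, N)`. -/
abbrev ExtMod (n : ℕ) (M N : Type u) [AddCommGroup M] [Module R M] [AddCommGroup N]
    [Module R N] : Type u :=
  Abelian.Ext (ModuleCat.of R M) (ModuleCat.of R N) n

/-- The minimal number of generators of a (finitely generated) module. -/
def numGen (M : Type u) [AddCommGroup M] [Module R M] : ℕ :=
  (⊤ : Submodule R M).spanFinrank

/-! ### Complexity and curvature of a pair of modules -/

section Pairs

variable (M N : Type u) [AddCommGroup M] [Module R M] [AddCommGroup N] [Module R N]

/-- The Ext-complexity `cx_R(M, N)`. -/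
def cxPair : ℕ∞ := cxSeq fun n => (numGen R (ExtMod R n M N) : ℝ)

/-- The Ext-curvature `curv_R(M, N)`. -/
def curvPair : ENNReal := curvSeq fun n => (numGen R (ExtMod R n M N) : ℝ)

/-- The Tor-complexity `tcx_R(M, N)`. -/
def tcx : ℕ∞ := cxSeq fun n => (numGen R (TorMod R n M N) : ℝ)

/-- The Tor-curvature `tcurv_R(M, N)`. -/
def tcurv : ENNReal := curvSeq fun n => (numGen R (TorMod R n M N) : ℝ)

end Pairs

/-! ### Torsionless modules and Gorenstein dimension -/

section GDim

/-- `X` is torsionless: the canonical map to the double dual is injective. -/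
def IsTorsionless (X : Type u) [AddCommGroup X] [Module R X] : Prop :=
  Function.Injective (Module.Dual.eval R X)

/-- `X` is totally reflexive, that is, a finitely generated module of Gorenstein dimension zero:
`X` is reflexive and `Ext^i(X, R) = 0 = Ext^i(X*, R)` for all `i ≥ 1`. -/
structure IsTotallyReflexive (X : Type u) [AddCommGroup X] [Module R X] : Prop where
  finite : Module.Finite R X
  reflexive : Module.IsReflexive R X
  ext_self : ∀ i : ℕ, 1 ≤ i → Subsingleton (ExtMod R i X R)
  ext_dual : ∀ i : ℕ, 1 ≤ i → Subsingleton (ExtMod R i (Module.Dual R X) R)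

/-- There is an exact sequence `0 → G_n → ⋯ → G_0 → X → 0` with all `G_i` totally reflexive
(some of them possibly zero). -/
def GDimLE : ℕ → ∀ (X : Type u) [AddCommGroup X] [Module R X], Prop
  | 0, X, _, _ => IsTotallyReflexive R X
  | n + 1, X, _, _ => ∃ (K G : ModuleCat.{u} R) (i : K →ₗ[R] G) (p : G →ₗ[R] X),
      IsTotallyReflexive R G ∧ Function.Injective i ∧ Function.Exact i p ∧
        Function.Surjective p ∧ GDimLE n K

/-- The Gorenstein dimension of `X` (with the value `0` for the zero module). -/
def gDim (X : Type u) [AddCommGroup X] [Module R X] : ℕ∞ :=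
  ⨅ (n : ℕ) (_ : GDimLE R n X), (n : ℕ∞)

end GDim

/-! ### Betti and Bass numbers; complexities and curvatures of a module -/

section Local

variable [IsLocalRing R]

lemma smul_id_residueField {r : R} (hr : r ∈ maximalIdeal R) :
    r • 𝟙 (ModuleCat.of R (ResidueField R)) = 0 := by
  refine ModuleCat.hom_ext (LinearMap.ext fun x => ?_)
  change r • (x : ResidueField R) = 0
  rw [Algebra.smul_def]
  exact mul_eq_zero_of_left ((residue_eq_zero_iff r).2 hr) x

lemma ext_residueField_torsion (n : ℕ) (M : Type u) [AddCommGroup M] [Module R M] :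
    Module.IsTorsionBySet R (ExtMod R n M (ResidueField R)) (maximalIdeal R : Set R) := by
  rintro x ⟨r, hr⟩
  change r • x = 0
  rw [Abelian.Ext.smul_eq_comp_mk₀, smul_id_residueField R hr, Abelian.Ext.mk₀_zero,
    Abelian.Ext.comp_zero]

lemma ext_from_residueField_torsion (n : ℕ) (M : Type u) [AddCommGroup M] [Module R M] :
    Module.IsTorsionBySet R (ExtMod R n (ResidueField R) M) (maximalIdeal R : Set R) := by
  rintro x ⟨r, hr⟩
  change r • x = 0
  rw [← Abelian.Ext.mk₀_id_comp x, ← Abelian.Ext.smul_comp, ← Abelian.Ext.mk₀_smul,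
    smul_id_residueField R hr, Abelian.Ext.mk₀_zero, Abelian.Ext.zero_comp]

variable (M : Type u) [AddCommGroup M] [Module R M]

/-- The `n`-th Betti number `rank_k Ext^n_R(M, k)`, where `k = R ⧸ 𝔪` acts on `Ext^n_R(M, k)`
because `𝔪` annihilates it. -/
def betti (n : ℕ) : ℕ :=
  letI : Module (R ⧸ maximalIdeal R) (ExtMod R n M (ResidueField R)) :=
    (ext_residueField_torsion R n M).module
  Module.finrank (R ⧸ maximalIdeal R) (ExtMod R n M (ResidueField R))

/-- The `n`-th Bass number `rank_k Ext^n_R(k, M)`. -/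
def bass (n : ℕ) : ℕ :=
  letI : Module (R ⧸ maximalIdeal R) (ExtMod R n (ResidueField R) M) :=
    (ext_from_residueField_torsion R n M).module
  Module.finrank (R ⧸ maximalIdeal R) (ExtMod R n (ResidueField R) M)

/-- The complexity `cx_R(M)`. -/
def cx : ℕ∞ := cxSeq fun n => (betti R M n : ℝ)

/-- The curvature `curv_R(M)`. -/
def curv : ENNReal := curvSeq fun n => (betti R M n : ℝ)

/-- The injective complexity `injcx_R(M)`. -/
def injcx : ℕ∞ := cxSeq fun n => (bass R M n : ℝ)

/-- The injective curvature `injcurv_R(M)`. -/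
def injcurv : ENNReal := curvSeq fun n => (bass R M n : ℝ)

end Local

end Modules

/-! ### Burch submodules -/

section Burch

variable {R : Type u} [CommRing R] {X : Type u} [AddCommGroup X] [Module R X]

/-- The submodule `(M :_X I) = {x ∈ X | I x ⊆ M}` of `X`. -/
def colonIn (M : Submodule R X) (I : Ideal R) : Submodule R X where
  carrier := {x | ∀ r ∈ I, r • x ∈ M}
  zero_mem' := fun r _ => by simp
  add_mem' := fun hx hy r hr => by
    rw [smul_add]
    exact M.add_mem (hx r hr) (hy r hr)
  smul_mem' := fun c x hx r hr => by
    rw [smul_comm]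
    exact M.smul_mem c (hx r hr)

/-- `M` is a Burch submodule of `X`: `𝔪 (M :_X 𝔪) ≠ 𝔪 M`. -/
def IsBurch [IsLocalRing R] (M : Submodule R X) : Prop :=
  maximalIdeal R • colonIn M (maximalIdeal R) ≠ maximalIdeal R • M

end Burch

end BurchGrowth

end

open BurchGrowth

/-!
If `M` is a Burch submodule of `X`, there are `r ∈ 𝔪` and `x ∈ (M :_X 𝔪)` with `r x ∉ 𝔪 M`, and then
`x ∉ M`. Put `M' = M + R x`, so that `M' / M ≅ k`. Multiplication by `r` maps `M'` into `M`, and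
composing it with a functional `M → k` that is nonzero at `r x` gives a surjection `M' → k` with
kernel `M`. Thus the surjection in `0 → M → M' → k → 0` factors through `M`, and in the long exact
sequence the image of `Tor_{n+1}(M', N)` in `Tor_{n+1}(k, N)` is contained in the image of
`Tor_{n+1}(M, N)`. Hence
`length Tor_{n+1}(k, N) ≤ length Tor_{n+1}(M, N) + length Tor_n(M, N)`,
and dually for `Ext`; moreover `Ext^{n+1}(N, k)` is dual to `Tor_{n+1}(k, N)`. A module killed by
`𝔪 ^ h` has length at most `μ · length (R / 𝔪 ^ h)`, and neither complexity nor curvature can grow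
when a sequence is replaced by one bounded by a constant multiple of the sum of two consecutive
terms.
-/

open MonoidalCategory

namespace BurchGrowth

section Growth

/-- `b` is eventually bounded by a constant multiple of the sum of two consecutive terms of `a`:
the relation between Betti numbers and `Tor` that a connecting homomorphism produces, and under
which both the complexity and the curvature of `b` are at most those of `a`. -/
def DominatedByConsecutive (b a : ℕ → ℝ) : Prop :=
  ∃ C : ℝ, 0 < C ∧ ∀ᶠ n in atTop, b (n + 1) ≤ C * (a (n + 1) + a n)

lemma eventually_add_one_iff {p : ℕ → Prop} :
    (∀ᶠ n in atTop, p (n + 1)) ↔ ∀ᶠ n in atTop, p n := by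
  conv_rhs => rw [← map_add_atTop_eq_nat 1, eventually_map]

lemma zpow_natCast_sub_one_le {x : ℝ} (hx : 1 ≤ x) (b : ℕ) :
    x ^ ((b : ℤ) - 1) ≤ 2 * (x + 1) ^ ((b : ℤ) - 1) := by
  have hx₀ : 0 < x := one_pos.trans_le hx
  rw [zpow_sub_one₀ hx₀.ne', zpow_sub_one₀ (by positivity), zpow_natCast, zpow_natCast]
  calc x ^ b * x⁻¹ ≤ (x + 1) ^ b * (2 * (x + 1)⁻¹) := by
        gcongr
        · linarith
        · rw [← div_eq_mul_inv, inv_le_comm₀ hx₀ (by positivity), inv_div]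
          linarith
    _ = 2 * ((x + 1) ^ b * (x + 1)⁻¹) := by ring

lemma DominatedByConsecutive.cxSeq_le {a b : ℕ → ℝ} (h : DominatedByConsecutive b a) :
    cxSeq b ≤ cxSeq a := by
  obtain ⟨C, hC, hba⟩ := h
  refine le_iInf₂ fun e ⟨α, hα, ha⟩ => iInf₂_le e ⟨C * (3 * α), by positivity, ?_⟩
  rw [← eventually_add_one_iff]
  filter_upwards [hba, ha, eventually_add_one_iff.2 ha, eventually_ge_atTop 1]
    with n hn ha_n ha_succ hn_one
  have hzpow := mul_le_mul_of_nonneg_left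
    (zpow_natCast_sub_one_le (x := n) (mod_cast hn_one) e) hα.le
  push_cast at ha_succ ⊢
  calc b (n + 1) ≤ C * (a (n + 1) + a n) := hn
    _ ≤ C * (3 * α * ((n : ℝ) + 1) ^ ((e : ℤ) - 1)) := by gcongr; linarith
    _ = C * (3 * α) * ((n : ℝ) + 1) ^ ((e : ℤ) - 1) := by ring

lemma eventually_le_pow_of_curvSeq_lt {a : ℕ → ℝ} {c : NNReal} (h : curvSeq a < c) :
    ∀ᶠ n in atTop, a n ≤ (c : ℝ) ^ n := by
  filter_upwards [eventually_lt_of_limsup_lt h, eventually_ne_atTop 0] with n hroot hn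
  obtain ha | ha := lt_or_ge (a n) 0
  · exact ha.le.trans (by positivity)
  · rw [one_div, ← ENNReal.ofReal_coe_nnreal] at hroot
    have hle : a n ^ ((n : ℝ)⁻¹) ≤ c :=
      (ENNReal.ofReal_le_ofReal_iff c.2).1 hroot.le
    calc a n = (a n ^ ((n : ℝ)⁻¹)) ^ n := (Real.rpow_inv_natCast_pow ha hn).symm
      _ ≤ (c : ℝ) ^ n := by gcongr

lemma curvSeq_le_of_eventually_le_mul_pow {b : ℕ → ℝ} {D : ℝ} {c : NNReal} (hb : ∀ n, 0 ≤ b n)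
    (hD : 0 < D) (h : ∀ᶠ n in atTop, b n ≤ D * (c : ℝ) ^ n) : curvSeq b ≤ c := by
  have hlim : Tendsto (fun n : ℕ => ENNReal.ofReal (D ^ (1 / (n : ℝ)) * c)) atTop
      (nhds (c : ENNReal)) := by
    have hroot : Tendsto (fun n : ℕ => D ^ (1 / (n : ℝ))) atTop (nhds (D ^ (0 : ℝ))) :=
      (Real.continuous_const_rpow hD.ne').continuousAt.tendsto.comp
        tendsto_one_div_atTop_nhds_zero_nat
    simpa using ENNReal.tendsto_ofReal (hroot.mul_const (c : ℝ))
  rw [← hlim.limsup_eq]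
  refine limsup_le_limsup ?_
  filter_upwards [h, eventually_ne_atTop 0] with n hbn hn
  refine ENNReal.ofReal_le_ofReal ?_
  calc b n ^ (1 / (n : ℝ)) ≤ (D * (c : ℝ) ^ n) ^ (1 / (n : ℝ)) :=
        Real.rpow_le_rpow (hb n) hbn (by positivity)
    _ = D ^ (1 / (n : ℝ)) * c := by
        rw [Real.mul_rpow hD.le (by positivity), one_div, Real.pow_rpow_inv_natCast c.coe_nonneg hn]

lemma DominatedByConsecutive.curvSeq_le {a b : ℕ → ℝ} (h : DominatedByConsecutive b a)
    (hb : ∀ n, 0 ≤ b n) : curvSeq b ≤ curvSeq a := by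
  obtain ⟨C, hC, hba⟩ := h
  refine le_of_forall_gt_imp_ge_of_dense fun c hac => ?_
  obtain rfl | hc_top := eq_or_ne c ⊤
  · exact le_top
  lift c to NNReal using hc_top
  have hc : 0 < c := ENNReal.coe_pos.1 (pos_of_gt hac)
  have ha := eventually_le_pow_of_curvSeq_lt hac
  refine curvSeq_le_of_eventually_le_mul_pow (D := C * (1 + (c : ℝ)⁻¹)) hb (by positivity) ?_
  rw [← eventually_add_one_iff]
  filter_upwards [hba, ha, eventually_add_one_iff.2 ha] with n hn ha_n ha_succ
  calc b (n + 1) ≤ C * (a (n + 1) + a n) := hn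
    _ ≤ C * ((c : ℝ) ^ (n + 1) + (c : ℝ) ^ n) := by gcongr
    _ = C * (1 + (c : ℝ)⁻¹) * (c : ℝ) ^ (n + 1) := by rw [pow_succ]; field_simp

end Growth

section Length

variable {R : Type*} [CommRing R]

lemma isArtinianRing_quotient_maximal_pow [IsNoetherianRing R] (m : Ideal R) [hm : m.IsMaximal]
    (h : ℕ) : IsArtinianRing (R ⧸ m ^ h) := by
  rw [isArtinianRing_iff_krullDimLE_zero, Ring.krullDimLE_zero_iff]
  intro p hp
  have hprime := hp.comap (Ideal.Quotient.mk (m ^ h))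
  have hle : m ≤ p.comap (Ideal.Quotient.mk (m ^ h)) := by
    refine hprime.le_of_pow_le (n := h) ?_
    rw [← Ideal.map_le_iff_le_comap, Ideal.map_quotient_self]
    exact bot_le
  refine Ideal.isMaximal_of_isIntegral_of_isMaximal_comap (R := R) p ?_
  exact hm.eq_of_le hprime.ne_top hle ▸ hm

lemma length_quotient_maximal_pow_ne_top [IsNoetherianRing R] (m : Ideal R) [m.IsMaximal]
    (h : ℕ) : Module.length R (R ⧸ m ^ h) ≠ ⊤ := by
  have := isArtinianRing_quotient_maximal_pow m h
  rw [Module.length_eq_of_surjective (R := R ⧸ m ^ h) (S := R) Ideal.Quotient.mk_surjective]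
  exact Module.length_ne_top

lemma length_le_numGen_mul_length_quotient {R : Type u} [CommRing R] (I : Ideal R) (T : Type u)
    [AddCommGroup T] [Module R T] [Module.Finite R T] (hT : I • (⊤ : Submodule R T) = ⊥) :
    Module.length R T ≤ numGen R T * Module.length R (R ⧸ I) := by
  classical
  obtain ⟨s, hcard, hspan⟩ :=
    (Module.Finite.fg_top (R := R) (M := T)).exists_span_finset_card_eq_spanFinrank
  have hI (t : T) : I ≤ LinearMap.ker (LinearMap.toSpanSingleton R T t) := fun r hr => by
    have hrt : r • t ∈ I • (⊤ : Submodule R T) := Submodule.smul_mem_smul hr trivial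
    simpa [hT] using hrt
  let g : (s → R ⧸ I) →ₗ[R] T :=
    LinearMap.lsum R (fun _ => R ⧸ I) R fun t => I.liftQ _ (hI t)
  have hg : Function.Surjective g := fun t => by
    have ht : t ∈ Submodule.span R (Set.range ((↑) : s → T)) := by simp [hspan]
    obtain ⟨c, rfl⟩ := (Submodule.mem_span_range_iff_exists_fun R).1 ht
    refine ⟨fun i => Submodule.Quotient.mk (c i), ?_⟩
    simp only [g, LinearMap.lsum_apply, LinearMap.coe_sum, Finset.sum_apply]
    rfl
  calc Module.length R T ≤ Module.length R (s → R ⧸ I) := Module.length_le_of_surjective g hg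
    _ = numGen R T * Module.length R (R ⧸ I) := by
      rw [Module.length_pi, ENat.card_eq_coe_fintype_card, Fintype.card_coe, hcard, numGen]

section Comparison

variable {A T B E Y : Type*} [AddCommGroup A] [Module R A] [AddCommGroup T] [Module R T]
  [AddCommGroup B] [Module R B] [AddCommGroup E] [Module R E] [AddCommGroup Y] [Module R Y]

lemma length_le_add_of_ker_le_range (f : A →ₗ[R] T) (δ : T →ₗ[R] B)
    (h : LinearMap.ker δ ≤ LinearMap.range f) :
    Module.length R T ≤ Module.length R A + Module.length R B := by
  rw [Module.length_eq_add_of_exact (LinearMap.ker δ).subtype δ.rangeRestrict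
    (Submodule.subtype_injective _) δ.surjective_rangeRestrict
    (by rw [LinearMap.exact_iff, LinearMap.ker_rangeRestrict, Submodule.range_subtype])]
  gcongr
  · exact (Module.length_le_of_injective _ (Submodule.inclusion_injective h)).trans
      (Module.length_le_of_surjective _ f.surjective_rangeRestrict)
  · exact Module.length_le_of_injective _ (Submodule.subtype_injective _)

lemma length_le_of_ker_le_ker_of_range_le_range (α : T →ₗ[R] E) (β : T →ₗ[R] Y) (γ : A →ₗ[R] Y)
    (hα : Function.Surjective α) (hker : LinearMap.ker β ≤ LinearMap.ker α)
    (hrange : LinearMap.range β ≤ LinearMap.range γ) :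
    Module.length R E ≤ Module.length R A :=
  calc Module.length R E ≤ Module.length R (T ⧸ LinearMap.ker β) :=
        Module.length_le_of_surjective ((LinearMap.ker β).liftQ α hker)
          (by rw [← LinearMap.range_eq_top, Submodule.range_liftQ, LinearMap.range_eq_top.2 hα])
    _ = Module.length R (LinearMap.range β) := β.quotKerEquivRange.length_eq
    _ ≤ Module.length R (LinearMap.range γ) :=
        Module.length_le_of_injective _ (Submodule.inclusion_injective hrange)
    _ ≤ Module.length R A := Module.length_le_of_surjective _ γ.surjective_rangeRestrict

end Comparison

section Hom

variable (S : Type*) [AddCommGroup S] [Module R S] [IsSimpleModule R S]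

lemma length_linearMap_le_of_simple (T : Type*) [AddCommGroup T] [Module R T]
    [IsSimpleModule R T] : Module.length R (T →ₗ[R] S) ≤ Module.length R T := by
  have := IsSimpleModule.nontrivial R T
  obtain ⟨t, ht⟩ := exists_ne (0 : T)
  have hinj : Function.Injective (LinearMap.applyₗ (R := R) (M₂ := S) t) := by
    rw [injective_iff_map_eq_zero]
    intro f hf
    ext x
    obtain ⟨r, rfl⟩ := IsSimpleModule.toSpanSingleton_surjective R ht x
    have : f t = 0 := hf
    simp [this]
  calc Module.length R (T →ₗ[R] S) ≤ Module.length R S := Module.length_le_of_injective _ hinj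
    _ = Module.length R T := by rw [Module.length_eq_one, Module.length_eq_one]

lemma length_linearMap_le (T : Type*) [AddCommGroup T] [Module R T] :
    Module.length R (T →ₗ[R] S) ≤ Module.length R T := by
  by_cases hT : IsFiniteLength R T
  · induction hT with
    | of_subsingleton => simp
    | @of_simple_quotient M _ _ N _ _ ih =>
      calc Module.length R (M →ₗ[R] S)
          ≤ Module.length R (M ⧸ N →ₗ[R] S) + Module.length R (N →ₗ[R] S) := by
            refine length_le_add_of_ker_le_range (LinearMap.lcomp R S N.mkQ)
              (LinearMap.lcomp R S N.subtype) fun f hf => ?_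
            have hNf : N ≤ LinearMap.ker f := fun x hx => LinearMap.congr_fun hf ⟨x, hx⟩
            exact ⟨N.liftQ f hNf, N.liftQ_mkQ f hNf⟩
        _ ≤ Module.length R (M ⧸ N) + Module.length R N :=
            add_le_add (length_linearMap_le_of_simple S _) ih
        _ = Module.length R M := by
            rw [add_comm, Module.length_eq_add_of_exact N.subtype N.mkQ N.subtype_injective
              N.mkQ_surjective (LinearMap.exact_subtype_mkQ N)]
  · rw [← Module.length_ne_top_iff, not_not] at hT
    simp [hT]

end Hom

lemma finrank_le_length (m : Ideal R) [m.IsMaximal] {T : Type*} [AddCommGroup T] [Module R T]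
    (hT : Module.IsTorsionBySet R T (m : Set R)) :
    letI : Module (R ⧸ m) T := hT.module
    (Module.finrank (R ⧸ m) T : ℕ∞) ≤ Module.length R T := by
  let : Module (R ⧸ m) T := hT.module
  let : Field (R ⧸ m) := Ideal.Quotient.field _
  have : IsScalarTower R (R ⧸ m) T := hT.isScalarTower
  rw [Module.length_eq_of_surjective (R := R ⧸ m) (S := R) Ideal.Quotient.mk_surjective]
  by_cases hfin : Module.Finite (R ⧸ m) T
  · exact (Module.length_eq_finrank (R ⧸ m) T).ge
  · simp [Module.finrank_of_not_finite hfin]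

end Length

section Burch

lemma exists_linearMap_quotient_apply_ne_zero {R M : Type*} [CommRing R] [AddCommGroup M]
    [Module R M] (m : Ideal R) [m.IsMaximal] {y : M} (hy : y ∉ m • (⊤ : Submodule R M)) :
    ∃ p : M →ₗ[R] R ⧸ m, p y ≠ 0 := by
  let : Field (R ⧸ m) := Ideal.Quotient.field m
  have hne : (m • (⊤ : Submodule R M)).mkQ y ≠ 0 := by simpa using hy
  obtain ⟨f, hf⟩ := Module.Projective.exists_dual_ne_zero (R ⧸ m) hne
  exact ⟨f.restrictScalars R ∘ₗ (m • (⊤ : Submodule R M)).mkQ, hf⟩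

variable {R : Type u} [CommRing R] {X : Type u} [AddCommGroup X] [Module R X]
  {M : Submodule R X}

lemma le_colonIn (M : Submodule R X) (I : Ideal R) : M ≤ colonIn M I :=
  fun _ hx r _ => M.smul_mem r hx

lemma sup_span_singleton_le_comap_lsmul {r : R} {x : X} (hx : r • x ∈ M) :
    M ⊔ R ∙ x ≤ M.comap (LinearMap.lsmul R X r) :=
  sup_le (fun _ hy => M.smul_mem r hy) ((Submodule.span_singleton_le_iff_mem _ _).2 hx)

variable [IsLocalRing R]

instance isSimpleModule_residueField : IsSimpleModule R (ResidueField R) :=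
  isSimpleModule_iff_quot_maximal.2 ⟨_, maximalIdeal.isMaximal R, ⟨LinearEquiv.refl R _⟩⟩

lemma smul_residueField_eq_zero_iff {a : R} {c : ResidueField R} :
    a • c = 0 ↔ a ∈ maximalIdeal R ∨ c = 0 := by
  rw [Algebra.smul_def, mul_eq_zero, ResidueField.algebraMap_eq, residue_eq_zero_iff]

lemma IsBurch.exists_smul_notMem (hM : IsBurch M) :
    ∃ r ∈ maximalIdeal R, ∃ x ∈ colonIn M (maximalIdeal R), r • x ∉ maximalIdeal R • M := by
  contrapose! hM
  exact not_not.2 <| le_antisymm (Submodule.smul_le.2 hM)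
    (Submodule.smul_mono le_rfl (le_colonIn M _))

lemma exact_inclusion_sup_span_singleton {x : X} (hx : x ∈ colonIn M (maximalIdeal R))
    (φ : ↥(M ⊔ R ∙ x) →ₗ[R] ResidueField R)
    (hφM : ∀ z : ↥(M ⊔ R ∙ x), (z : X) ∈ M → φ z = 0)
    (hφx : φ ⟨x, Submodule.mem_sup_right (Submodule.mem_span_singleton_self x)⟩ ≠ 0) :
    Function.Exact (Submodule.inclusion (le_sup_left : M ≤ M ⊔ R ∙ x)) φ := by
  intro z
  refine ⟨fun hz => ?_, ?_⟩
  · obtain ⟨y, hy, w, hw, hyw⟩ := Submodule.mem_sup.1 z.2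
    obtain ⟨a, rfl⟩ := Submodule.mem_span_singleton.1 hw
    have hφz : φ z = a • φ ⟨x, Submodule.mem_sup_right (Submodule.mem_span_singleton_self x)⟩ := by
      rw [← map_smul, ← sub_eq_zero, ← map_sub]
      exact hφM _ (by simpa [← hyw] using hy)
    have ha : a ∈ maximalIdeal R :=
      (smul_residueField_eq_zero_iff.1 (hφz.symm.trans hz)).resolve_right hφx
    exact ⟨⟨z, hyw ▸ M.add_mem hy (hx a ha)⟩, rfl⟩
  · rintro ⟨y, rfl⟩
    exact hφM _ y.2

lemma IsBurch.exists_factorization (hM : IsBurch M) :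
    ∃ (M' : Submodule R X) (hle : M ≤ M') (ρ : M' →ₗ[R] M) (p : M →ₗ[R] ResidueField R),
      Function.Exact (Submodule.inclusion hle) (p ∘ₗ ρ) ∧ Function.Surjective (p ∘ₗ ρ) := by
  obtain ⟨r, hr, x, hx, hrx⟩ := hM.exists_smul_notMem
  have hy : (⟨r • x, hx r hr⟩ : M) ∉ maximalIdeal R • (⊤ : Submodule R M) := fun hmem => hrx <| by
    simpa [Submodule.map_smul''] using Submodule.mem_map_of_mem (f := M.subtype) hmem
  obtain ⟨p, hp⟩ := exists_linearMap_quotient_apply_ne_zero (maximalIdeal R) hy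
  let ρ : ↥(M ⊔ R ∙ x) →ₗ[R] M :=
    (r • (M ⊔ R ∙ x).subtype).codRestrict M fun z =>
      sup_span_singleton_le_comap_lsmul (hx r hr) z.2
  have hφM (z : ↥(M ⊔ R ∙ x)) (hz : (z : X) ∈ M) : p (ρ z) = 0 := by
    have hρz : ρ z = r • ⟨z, hz⟩ := rfl
    rw [hρz, map_smul]
    exact smul_residueField_eq_zero_iff.2 (.inl hr)
  exact ⟨M ⊔ R ∙ x, le_sup_left, ρ, p, exact_inclusion_sup_span_singleton hx _ hφM hp,
    LinearMap.surjective_of_ne_zero fun h => hp (LinearMap.congr_fun h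
      ⟨x, Submodule.mem_sup_right (Submodule.mem_span_singleton_self x)⟩)⟩

lemma IsBurch.exists_shortExact (hM : IsBurch M) :
    ∃ (B : ModuleCat.{u} R) (i : ModuleCat.of R M ⟶ B) (ρ : B ⟶ ModuleCat.of R M)
      (p : ModuleCat.of R M ⟶ ModuleCat.of R (ResidueField R)) (w : i ≫ ρ ≫ p = 0),
      (ShortComplex.mk i (ρ ≫ p) w).ShortExact := by
  obtain ⟨M', hle, ρ, p, hexact, hsurj⟩ := hM.exists_factorization
  have w : ModuleCat.ofHom (Submodule.inclusion hle) ≫ ModuleCat.ofHom ρ ≫ ModuleCat.ofHom p = 0 :=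
    ModuleCat.hom_ext hexact.linearMap_comp_eq_zero
  exact ⟨ModuleCat.of R M', ModuleCat.ofHom (Submodule.inclusion hle), ModuleCat.ofHom ρ,
    ModuleCat.ofHom p, w, ModuleCat.shortComplex_shortExact _ hexact
      (Submodule.inclusion_injective hle) hsurj⟩

end Burch

section Tor

variable {R : Type u} [CommRing R]

/-- The complex `A ⊗ P`. -/
noncomputable abbrev tensorComplex (A : ModuleCat.{u} R) (P : ChainComplex (ModuleCat.{u} R) ℕ) :
    ChainComplex (ModuleCat.{u} R) ℕ :=
  (((tensoringLeft (ModuleCat.{u} R)).obj A).mapHomologicalComplex _).obj P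

/-- The map of complexes `f ⊗ P`. -/
noncomputable abbrev tensorComplexMap {A B : ModuleCat.{u} R} (f : A ⟶ B)
    (P : ChainComplex (ModuleCat.{u} R) ℕ) : tensorComplex A P ⟶ tensorComplex B P :=
  (NatTrans.mapHomologicalComplex ((tensoringLeft (ModuleCat.{u} R)).map f) _).app P

/-- The short complex of complexes `S₁ ⊗ P ⟶ S₂ ⊗ P ⟶ S₃ ⊗ P`, from which the long exact sequence
of `Tor` in the first variable arises. -/
noncomputable abbrev tensorShortComplex (S : ShortComplex (ModuleCat.{u} R))
    (P : ChainComplex (ModuleCat.{u} R) ℕ) :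
    ShortComplex (ChainComplex (ModuleCat.{u} R) ℕ) where
  f := tensorComplexMap S.f P
  g := tensorComplexMap S.g P
  zero := by
    ext n : 1
    change S.f ▷ P.X n ≫ S.g ▷ P.X n = 0
    rw [← comp_whiskerRight, S.zero, MonoidalPreadditive.zero_whiskerRight]

lemma tensorShortComplex_shortExact {S : ShortComplex (ModuleCat.{u} R)} (hS : S.ShortExact)
    (P : ChainComplex (ModuleCat.{u} R) ℕ) [∀ n, Module.Flat R (P.X n)] :
    (tensorShortComplex S P).ShortExact :=
  HomologicalComplex.shortExact_of_degreewise_shortExact _ fun n =>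
    hS.map_of_exact (tensorRight (P.X n))

variable {N : ModuleCat.{u} R} (P : ProjectiveResolution N)

instance flat_projectiveResolution_complex_X (n : ℕ) : Module.Flat R (P.complex.X n) :=
  have : Module.Projective R (P.complex.X n) :=
    (IsProjective.iff_projective _).2 (P.projective n)
  inferInstance

/-- The computation of `Tor_n(A, N)` as the homology of `A ⊗ P`, for a projective resolution `P`
of `N`. -/
noncomputable def torIso (A : ModuleCat.{u} R) (n : ℕ) :
    ((Tor (ModuleCat.{u} R) n).obj A).obj N ≅ (tensorComplex A P.complex).homology n :=
  P.isoLeftDerivedObj ((tensoringLeft (ModuleCat.{u} R)).obj A) n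

lemma torIso_hom_naturality {A B : ModuleCat.{u} R} (f : A ⟶ B) (n : ℕ) :
    ((Tor (ModuleCat.{u} R) n).map f).app N ≫ (torIso P B n).hom =
      (torIso P A n).hom ≫ HomologicalComplex.homologyMap (tensorComplexMap f P.complex) n := by
  rw [← Iso.eq_comp_inv, Category.assoc]
  exact P.leftDerived_app_eq ((tensoringLeft (ModuleCat.{u} R)).map f) n

variable {S : ShortComplex (ModuleCat.{u} R)} (hS : S.ShortExact) (n : ℕ)

/-- The connecting homomorphism `Tor_{n+1}(S₃, N) ⟶ Tor_n(S₁, N)` of a short exact sequence `S` in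
the first variable, computed with a projective resolution `P` of `N`. -/
noncomputable def torδ :
    ((Tor (ModuleCat.{u} R) (n + 1)).obj S.X₃).obj N ⟶ ((Tor (ModuleCat.{u} R) n).obj S.X₁).obj N :=
  (torIso P S.X₃ (n + 1)).hom ≫
    (tensorShortComplex_shortExact hS P.complex).δ (n + 1) n rfl ≫ (torIso P S.X₁ n).inv

lemma tor_map_comp_torδ :
    ((Tor (ModuleCat.{u} R) (n + 1)).map S.g).app N ≫ torδ P hS n = 0 := by
  have hδ : HomologicalComplex.homologyMap (tensorComplexMap S.g P.complex) (n + 1) ≫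
      (tensorShortComplex_shortExact hS P.complex).δ (n + 1) n rfl = 0 :=
    (tensorShortComplex_shortExact hS P.complex).comp_δ (n + 1) n rfl
  rw [torδ, reassoc_of% torIso_hom_naturality P S.g (n + 1), reassoc_of% hδ, Limits.zero_comp,
    Limits.comp_zero]

lemma torδ_exact : (ShortComplex.mk _ _ (tor_map_comp_torδ P hS n)).Exact := by
  refine (ShortComplex.exact_iff_of_iso ?_).2
    ((tensorShortComplex_shortExact hS P.complex).homology_exact₃ (n + 1) n rfl)
  refine ShortComplex.isoMk (torIso P S.X₂ (n + 1)) (torIso P S.X₃ (n + 1)) (torIso P S.X₁ n)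
    (torIso_hom_naturality P S.g (n + 1)).symm ?_
  simp [torδ]

lemma ker_torδ_le_range : LinearMap.ker (torδ P hS n).hom ≤
    LinearMap.range (((Tor (ModuleCat.{u} R) (n + 1)).map S.g).app N).hom :=
  (ShortComplex.moduleCat_exact_iff_ker_sub_range _).1 (torδ_exact P hS n)

lemma isZero_tor_succ_of_flat (F N : ModuleCat.{u} R) [Module.Flat R F] (n : ℕ) :
    Limits.IsZero (((Tor (ModuleCat.{u} R) (n + 1)).obj F).obj N) := by
  let P := projectiveResolution N
  refine Limits.IsZero.of_iso ?_ (torIso P F (n + 1))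
  refine (HomologicalComplex.exactAt_iff_isZero_homology _ _).1 ?_
  exact Module.Flat.lTensor_shortComplex_exact F (P.complex.sc (n + 1)) (P.complex_exactAt_succ n)

-- Dimension shifting along `0 → K → F → M → 0` with `F` finite free.
instance finite_tor [IsNoetherianRing R] (M N : ModuleCat.{u} R) [Module.Finite R M]
    [Module.Finite R N] (n : ℕ) :
    Module.Finite R (((Tor (ModuleCat.{u} R) n).obj M).obj N) := by
  induction n generalizing M with
  | zero =>
    have : Module.Finite R (((tensoringLeft (ModuleCat.{u} R)).obj M).obj N) :=
      inferInstanceAs (Module.Finite R (TensorProduct R M N))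
    exact Module.Finite.equiv (((tensoringLeft (ModuleCat.{u} R)).obj M).leftDerivedZeroIsoSelf.app
      N).toLinearEquiv.symm
  | succ n ih =>
    obtain ⟨F, _, _, _, _, f, hf⟩ := Module.exists_finite_presentation R M
    have hS := LinearMap.shortExact_shortComplexKer hf
    have hδ := torδ_exact (projectiveResolution N) hS n
    have hmono := hδ.mono_g ((isZero_tor_succ_of_flat (ModuleCat.of R F) N n).eq_of_src _ _)
    have := ih (ModuleCat.of R (LinearMap.ker f))
    exact Module.Finite.of_injective (torδ (projectiveResolution N) hS n).hom
      ((ModuleCat.mono_iff_injective _).1 hmono)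

end Tor

section Betti

open TensorProduct

section ExtendFunctional

variable {R : Type*} [CommRing R] (k : Type*) [Field k] [Algebra R k] {V W : Type*}
  [AddCommGroup V] [Module R V] [AddCommGroup W] [Module R W]

/-- The `R`-linear map extending functionals on `V` to functionals on `k ⊗ V`. -/
noncomputable def extendFunctional :
    (V →ₗ[R] k) →ₗ[R] k ⊗[R] V →ₗ[R] k :=
  LinearMap.restrictScalarsₗ R k _ _ R ∘ₗ
    (LinearMap.liftBaseChangeEquiv k).toLinearMap.restrictScalars R

variable {k} in
lemma exists_comp_eq_of_ker_baseChange_le (d : V →ₗ[R] W) (f : V →ₗ[R] k)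
    (h : LinearMap.ker (d.baseChange k) ≤ LinearMap.ker (f.liftBaseChange k)) :
    ∃ g : W →ₗ[R] k, g ∘ₗ d = f := by
  have hmem : f.liftBaseChange k ∈ LinearMap.range (d.baseChange k).dualMap := by
    rw [LinearMap.range_dualMap_eq_dualAnnihilator_ker, Submodule.mem_dualAnnihilator]
    exact fun x hx => h hx
  obtain ⟨g, hg⟩ := hmem
  refine ⟨g.restrictScalars R ∘ₗ TensorProduct.mk R k W 1, LinearMap.ext fun v => ?_⟩
  simpa using LinearMap.congr_fun hg (1 ⊗ₜ v)

end ExtendFunctional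

variable {R : Type u} [CommRing R] {N : ModuleCat.{u} R} (P : ProjectiveResolution N)

/-- The `n`-cocycles of the complex `Hom(P, L)`. -/
noncomputable abbrev homCocycles (L : ModuleCat.{u} R) (n : ℕ) :
    Submodule R (P.complex.X n →ₗ[R] L) :=
  LinearMap.ker (LinearMap.lcomp R L (P.complex.d (n + 1) n).hom)

/-- The linear map sending a cocycle of `Hom(P, L)` to its class in `Ext^n(N, L)`. -/
noncomputable def cocyclesToExt (L : ModuleCat.{u} R) (n : ℕ) :
    homCocycles P L n →ₗ[R] Abelian.Ext N L n where
  toFun f := P.extMk (ModuleCat.ofHom f.1) (n + 1) rfl (ModuleCat.hom_ext f.2)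
  map_add' f g := by
    rw [P.add_extMk]
    rfl
  map_smul' r f := by
    rw [RingHom.id_apply, Abelian.Ext.smul_eq_comp_mk₀, P.extMk_comp_mk₀]
    congr 1

lemma cocyclesToExt_surjective (L : ModuleCat.{u} R) (n : ℕ) :
    Function.Surjective (cocyclesToExt P L n) := fun x => by
  obtain ⟨f, hf, rfl⟩ := P.extMk_surjective x (n + 1) rfl
  exact ⟨⟨f.hom, congrArg ModuleCat.Hom.hom hf⟩, rfl⟩

lemma cocyclesToExt_succ_eq_zero {L : ModuleCat.{u} R} {n : ℕ} (f : homCocycles P L (n + 1))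
    (g : P.complex.X n →ₗ[R] L) (hg : g ∘ₗ (P.complex.d (n + 1) n).hom = f.1) :
    cocyclesToExt P L (n + 1) f = 0 :=
  (P.extMk_eq_zero_iff _ _ rfl (ModuleCat.hom_ext f.2) n rfl).2
    ⟨ModuleCat.ofHom g, ModuleCat.hom_ext hg⟩

variable (k : Type u) [Field k] [Algebra R k]

/-- Evaluation of the cocycles of `Hom(P, k)` on the cycles of `k ⊗ P`. -/
noncomputable def evalCycles (n : ℕ) :
    homCocycles P (ModuleCat.of R k) n →ₗ[R]
      ((tensorComplex (ModuleCat.of R k) P.complex).cycles n →ₗ[R] k) :=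
  LinearMap.lcomp R k ((tensorComplex (ModuleCat.of R k) P.complex).iCycles n).hom ∘ₗ
    extendFunctional k ∘ₗ (homCocycles P (ModuleCat.of R k) n).subtype

lemma d_comp_extendFunctional {n : ℕ} (f : homCocycles P (ModuleCat.of R k) n) :
    (tensorComplex (ModuleCat.of R k) P.complex).d (n + 1) n ≫
      ModuleCat.ofHom (Y := k) (extendFunctional k f.1) = 0 := by
  refine ModuleCat.hom_ext (TensorProduct.ext' fun a v => ?_)
  have hf : f.1 ((P.complex.d (n + 1) n).hom v) = 0 := LinearMap.congr_fun f.2 v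
  change a • f.1 ((P.complex.d (n + 1) n).hom v) = 0
  rw [hf, smul_zero]

lemma range_evalCycles_le (n : ℕ) :
    LinearMap.range (evalCycles P k n) ≤ LinearMap.range
      (LinearMap.lcomp R k ((tensorComplex (ModuleCat.of R k) P.complex).homologyπ n).hom) := by
  rintro _ ⟨f, rfl⟩
  let K := tensorComplex (ModuleCat.of R k) P.complex
  let φ : K.opcycles n ⟶ ModuleCat.of R k :=
    K.descOpcycles (ModuleCat.ofHom (extendFunctional k f.1)) (n + 1) (by simp)
      (d_comp_extendFunctional P k f)
  refine ⟨(K.homologyι n ≫ φ).hom, ?_⟩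
  have hφ : K.homologyπ n ≫ K.homologyι n ≫ φ =
      K.iCycles n ≫ ModuleCat.ofHom (extendFunctional k f.1) := by
    rw [K.homology_π_ι_assoc]
    exact congrArg (K.iCycles n ≫ ·) (K.p_descOpcycles _ _ _ _)
  exact congrArg ModuleCat.Hom.hom hφ

lemma ker_evalCycles_le (n : ℕ) :
    LinearMap.ker (evalCycles P k (n + 1)) ≤
      LinearMap.ker (cocyclesToExt P (ModuleCat.of R k) (n + 1)) := by
  intro f hf
  let K := tensorComplex (ModuleCat.of R k) P.complex
  have hcycles : (ShortComplex.mk (K.iCycles (n + 1)) (K.d (n + 1) n) (K.iCycles_d _ _)).Exact :=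
    ShortComplex.exact_of_f_is_kernel _ (K.cyclesIsKernel (n + 1) n (by simp))
  obtain ⟨g, hg⟩ := exists_comp_eq_of_ker_baseChange_le (P.complex.d (n + 1) n).hom f.1
    fun x hx => by
      obtain ⟨c, rfl⟩ := (ShortComplex.moduleCat_exact_iff _).1 hcycles x hx
      exact LinearMap.congr_fun hf c
  exact cocyclesToExt_succ_eq_zero P f g hg

lemma length_ext_succ_le_length_tor_succ [IsSimpleModule R k] (N : ModuleCat.{u} R) (n : ℕ) :
    Module.length R (Abelian.Ext N (ModuleCat.of R k) (n + 1)) ≤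
      Module.length R (((Tor (ModuleCat.{u} R) (n + 1)).obj (ModuleCat.of R k)).obj N) := by
  let P := projectiveResolution N
  let H := (tensorComplex (ModuleCat.of R k) P.complex).homology (n + 1)
  calc Module.length R (Abelian.Ext N (ModuleCat.of R k) (n + 1))
      ≤ Module.length R (H →ₗ[R] k) :=
        length_le_of_ker_le_ker_of_range_le_range _ _ _ (cocyclesToExt_surjective P _ (n + 1))
          (ker_evalCycles_le P k n) (range_evalCycles_le P k (n + 1))
    _ ≤ Module.length R H := length_linearMap_le k H
    _ = _ := (torIso P (ModuleCat.of R k) (n + 1)).toLinearEquiv.length_eq.symm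

lemma betti_succ_le_length_tor [IsLocalRing R] (N : Type u) [AddCommGroup N] [Module R N] (n : ℕ) :
    (betti R N (n + 1) : ℕ∞) ≤ Module.length R (TorMod R (n + 1) (ResidueField R) N) :=
  (finrank_le_length _ (ext_residueField_torsion R (n + 1) N)).trans
    (length_ext_succ_le_length_tor_succ (ResidueField R) (ModuleCat.of R N) n)

end Betti

section Factorization

variable {R : Type u} [CommRing R] {A B C : ModuleCat.{u} R} (N : ModuleCat.{u} R)
  {i : A ⟶ B} {ρ : B ⟶ A} {p : A ⟶ C} (w : i ≫ ρ ≫ p = 0)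
  (hS : (ShortComplex.mk i (ρ ≫ p) w).ShortExact) (n : ℕ)

include hS

lemma length_tor_le_of_factorization :
    Module.length R (((Tor (ModuleCat.{u} R) (n + 1)).obj C).obj N) ≤
      Module.length R (((Tor (ModuleCat.{u} R) (n + 1)).obj A).obj N) +
        Module.length R (((Tor (ModuleCat.{u} R) n).obj A).obj N) := by
  refine length_le_add_of_ker_le_range (((Tor (ModuleCat.{u} R) (n + 1)).map p).app N).hom
    (torδ (projectiveResolution N) hS n).hom ((ker_torδ_le_range _ hS n).trans ?_)
  rw [Functor.map_comp, NatTrans.comp_app, ModuleCat.hom_comp]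
  exact LinearMap.range_comp_le_range _ _

lemma length_ext_le_of_factorization :
    Module.length R (Abelian.Ext C N (n + 1)) ≤
      Module.length R (Abelian.Ext A N n) + Module.length R (Abelian.Ext A N (n + 1)) := by
  refine length_le_add_of_ker_le_range
    (hS.extClass.precompOfLinear R N (add_comm 1 n))
    ((Abelian.Ext.mk₀ p).precompOfLinear R N (zero_add (n + 1))) fun x hx => ?_
  have hpx : (Abelian.Ext.mk₀ p).comp x (zero_add (n + 1)) = 0 := hx
  refine Abelian.Ext.contravariant_sequence_exact₃ hS N x ?_ (add_comm 1 n)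
  rw [← Abelian.Ext.mk₀_comp_mk₀_assoc, hpx, Abelian.Ext.comp_zero]

end Factorization

variable {R : Type u} [CommRing R]

lemma dominatedByConsecutive_numGen [IsNoetherianRing R] (m : Ideal R) [m.IsMaximal] {h : ℕ}
    (T : ℕ → Type u) [∀ n, AddCommGroup (T n)] [∀ n, Module R (T n)] [∀ n, Module.Finite R (T n)]
    (hT : ∀ᶠ n in atTop, m ^ h • (⊤ : Submodule R (T n)) = ⊥) {b : ℕ → ℕ}
    (hb : ∀ n, (b (n + 1) : ℕ∞) ≤ Module.length R (T (n + 1)) + Module.length R (T n)) :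
    DominatedByConsecutive (fun n => (b n : ℝ)) fun n => (numGen R (T n) : ℝ) := by
  obtain ⟨c, hc⟩ := ENat.ne_top_iff_exists.1 (length_quotient_maximal_pow_ne_top m h)
  refine ⟨c + 1, by positivity, ?_⟩
  filter_upwards [hT, eventually_add_one_iff.2 hT] with n hT_n hT_succ
  have hbn : (b (n + 1) : ℕ∞) ≤ (numGen R (T (n + 1)) + numGen R (T n)) * c :=
    calc (b (n + 1) : ℕ∞) ≤ Module.length R (T (n + 1)) + Module.length R (T n) := hb n
      _ ≤ numGen R (T (n + 1)) * c + numGen R (T n) * c := by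
        rw [hc]
        exact add_le_add (length_le_numGen_mul_length_quotient _ _ hT_succ)
          (length_le_numGen_mul_length_quotient _ _ hT_n)
      _ = (numGen R (T (n + 1)) + numGen R (T n)) * c := (add_mul _ _ _).symm
  have hbn_real : (b (n + 1) : ℝ) ≤ (numGen R (T (n + 1)) + numGen R (T n)) * c :=
    mod_cast hbn
  linarith [(by positivity : (0 : ℝ) ≤ numGen R (T (n + 1)) + numGen R (T n))]

variable [IsLocalRing R] {X N : Type u} [AddCommGroup X] [Module R X] [AddCommGroup N]
  [Module R N] {M : Submodule R X}

lemma IsBurch.betti_succ_le (hM : IsBurch M) (n : ℕ) :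
    (betti R N (n + 1) : ℕ∞) ≤
      Module.length R (TorMod R (n + 1) M N) + Module.length R (TorMod R n M N) := by
  obtain ⟨B, i, ρ, p, w, hS⟩ := hM.exists_shortExact
  exact (betti_succ_le_length_tor N n).trans
    (length_tor_le_of_factorization (ModuleCat.of R N) w hS n)

lemma IsBurch.bass_succ_le (hM : IsBurch M) (n : ℕ) :
    (bass R N (n + 1) : ℕ∞) ≤
      Module.length R (ExtMod R (n + 1) M N) + Module.length R (ExtMod R n M N) := by
  obtain ⟨B, i, ρ, p, w, hS⟩ := hM.exists_shortExact
  calc (bass R N (n + 1) : ℕ∞) ≤ Module.length R (ExtMod R (n + 1) (ResidueField R) N) :=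
        finrank_le_length _ (ext_from_residueField_torsion R (n + 1) N)
    _ ≤ Module.length R (ExtMod R (n + 1) M N) + Module.length R (ExtMod R n M N) :=
        (length_ext_le_of_factorization (ModuleCat.of R N) w hS n).trans_eq (add_comm _ _)

end BurchGrowth

theorem mainTheorem3_general {R : Type u} [CommRing R] [IsLocalRing R] [IsNoetherianRing R]
    {X N : Type u} [AddCommGroup X] [Module R X] [AddCommGroup N] [Module R N] [Module.Finite R N]
    (M : Submodule R X) [Module.Finite R M] (hM : IsBurch M) :
    ((∃ h : ℕ, ∀ᶠ n in atTop,
        maximalIdeal R ^ h • (⊤ : Submodule R (TorMod R n M N)) = ⊥) →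
      cx R N ≤ tcx R M N ∧ curv R N ≤ tcurv R M N) ∧
    ((∃ h : ℕ, ∀ᶠ n in atTop,
        maximalIdeal R ^ h • (⊤ : Submodule R (ExtMod R n M N)) = ⊥) →
      injcx R N ≤ cxPair R M N ∧ injcurv R N ≤ curvPair R M N) := by
  constructor
  · rintro ⟨h, hT⟩
    have hdom := dominatedByConsecutive_numGen (maximalIdeal R) (fun n => TorMod R n M N) hT
      (b := betti R N) hM.betti_succ_le
    exact ⟨hdom.cxSeq_le, hdom.curvSeq_le fun _ => Nat.cast_nonneg _⟩
  · rintro ⟨h, hT⟩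
    have hdom := dominatedByConsecutive_numGen (maximalIdeal R) (fun n => ExtMod R n M N) hT
      (b := bass R N) hM.bass_succ_le
    exact ⟨hdom.cxSeq_le, hdom.curvSeq_le fun _ => Nat.cast_nonneg _⟩

theorem mainTheorem3 {R : Type u} [CommRing R] [IsLocalRing R] [IsNoetherianRing R]
    {X N : Type u} [AddCommGroup X] [Module R X] [Module.Finite R X]
    [AddCommGroup N] [Module R N] [Module.Finite R N]
    (M : Submodule R X) (hM : IsBurch M)
    (hX : gDim R X < ⊤ ∨ IsTorsionless R X) :
    ((∃ h : ℕ, 0 < h ∧ ∃ n₀ : ℕ, ∀ n ≥ n₀,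
        maximalIdeal R ^ h • (⊤ : Submodule R (TorMod R n M N)) = ⊥) →
      cx R N ≤ tcx R M N ∧ curv R N ≤ tcurv R M N) ∧
    ((∃ h : ℕ, 0 < h ∧ ∃ n₀ : ℕ, ∀ n ≥ n₀,
        maximalIdeal R ^ h • (⊤ : Submodule R (ExtMod R n M N)) = ⊥) →
      injcx R N ≤ cxPair R M N ∧ injcurv R N ≤ curvPair R M N) :=
  (mainTheorem3_general M hM).imp
    (fun hTor ⟨h, _, hT⟩ => hTor ⟨h, eventually_atTop.2 hT⟩)
    (fun hExt ⟨h, _, hT⟩ => hExt ⟨h, eventually_atTop.2 hT⟩)
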